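/- Let $k$ be a field and let $C$, $D$ be (coassociative, counital) $k$-coalgebras. Write $\mathcal D^+(C)$ for the full subcategory of the derived category of the abelian category of left $C$-comodules on the objects isomorphic to left-bounded complexes. Write $\mathcal H_I^+(C)$ for the homotopy category of left-bounded complexes of injective left $C$-comodules (morphisms are homotopy classes of maps of complexes), and $\mathcal H_I^b(C)$ for its full subcategory on the objects that are isomorphic in $\mathcal H_I^+(C)$ to a bounded complex of injective comodules. Both $\mathcal D^+$ and $\mathcal H_I^+$ carry their usual triangulated structures; a triangulated equivalence is an equivalence of categories that commutes with the shift and preserves distinguished triangles. Then: 1. $\mathcal D^+(C)$ and $\mathcal D^+(D)$ are equivalent as triangulated categories if and only if $\mathcal H_I^+(C)$ and $\mathcal H_I^+(D)$ are equivalent as triangulated categories. 2. Every triangulated equivalence $F:\mathcal H_I^+(C)\to\mathcal H_I^+(D)$ maps $\mathcal H_I^b(C)$ into $\mathcal H_I^b(D)$, and the induced functor $\mathcal H_I^b(C)\to\mathcal H_I^b(D)$ is an equivalence of categories. -/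

import Mathlib

open CategoryTheory Limits MonoidalCategory Pretriangulated
open scoped TensorProduct

universe u

noncomputable section

namespace CoalgComod

/-! ### Comodules over a coalgebra -/

/-- The map `ε ⊗ id : C ⊗ M → k ⊗ M = M`. -/
def counitApp (k : Type u) [Field k] (C : Type u) [AddCommGroup C] [Module k C] [Coalgebra k C]
    (M : Type u) [AddCommGroup M] [Module k M] : C ⊗[k] M →ₗ[k] M :=
  (TensorProduct.lid k M).toLinearMap ∘ₗ (Coalgebra.counit (R := k) (A := C)).rTensor M

/-- The map `Δ ⊗ id : C ⊗ M → (C ⊗ C) ⊗ M = C ⊗ (C ⊗ M)`. -/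
def comulApp (k : Type u) [Field k] (C : Type u) [AddCommGroup C] [Module k C] [Coalgebra k C]
    (M : Type u) [AddCommGroup M] [Module k M] : C ⊗[k] M →ₗ[k] C ⊗[k] (C ⊗[k] M) :=
  (TensorProduct.assoc k C C M).toLinearMap ∘ₗ (Coalgebra.comul (R := k) (A := C)).rTensor M

lemma lTensor_lTensor_assoc (k : Type u) [Field k] (C : Type u) [AddCommGroup C] [Module k C]
    (M N : Type u) [AddCommGroup M] [Module k M] [AddCommGroup N] [Module k N] (f : M →ₗ[k] N) (c : C ⊗[k] C) (m : M):
   (f.lTensor C).lTensor C (TensorProduct.assoc k C C M (c ⊗ₜ m)) = TensorProduct.assoc k C C N (c ⊗ₜ f m) := by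
  induction c with
  | zero => simp
  | tmul => simp
  | add x y hx hy => simp only [TensorProduct.add_tmul, map_add, hx, hy]

lemma comulApp_naturality (k : Type u) [Field k] (C : Type u) [AddCommGroup C] [Module k C] [Coalgebra k C]
    (M N : Type u) [AddCommGroup M] [Module k M] [AddCommGroup N] [Module k N] (f : M →ₗ[k] N) :
   (f.lTensor C).lTensor C ∘ₗ comulApp k C M = comulApp k C N ∘ₗ f.lTensor C :=
  TensorProduct.ext' fun c m => by simp [comulApp, lTensor_lTensor_assoc]

lemma counitApp_comp_comulApp (k : Type u) [Field k] (C : Type u) [AddCommGroup C] [Module k C] [Coalgebra k C]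
    (M : Type u) [AddCommGroup M] [Module k M]  :
   (counitApp k C (C ⊗[k] M)) ∘ₗ comulApp k C M = LinearMap.id :=
  TensorProduct.ext' fun c m => by
    have h := Coalgebra.rTensor_counit_comul (R := k) c
    have : ∀ x : C ⊗[k] C, counitApp k C (C ⊗[k] M) (TensorProduct.assoc k C C M (x ⊗ₜ m)) =
       TensorProduct.lid k C ((Coalgebra.counit (R := k) (A := C)).rTensor C x) ⊗ₜ m := fun x => by
      induction x with
      | zero => simp
      | tmul a b => simp [counitApp, TensorProduct.smul_tmul']
      | add x y hx hy => simp only [TensorProduct.add_tmul, map_add, hx, hy]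
    simp [comulApp, this, h]

lemma lTensor_counitApp_comp_comulApp (k : Type u) [Field k] (C : Type u) [AddCommGroup C] [Module k C] [Coalgebra k C]
    (M : Type u) [AddCommGroup M] [Module k M]  :
   (counitApp k C M).lTensor C ∘ₗ comulApp k C M = LinearMap.id :=
  TensorProduct.ext' fun c m => by
    have h := Coalgebra.lTensor_counit_comul (R := k) c
    have : ∀ x : C ⊗[k] C, (counitApp k C M).lTensor C (TensorProduct.assoc k C C M (x ⊗ₜ m)) =
       TensorProduct.rid k C ((Coalgebra.counit (R := k) (A := C)).lTensor C x) ⊗ₜ m := fun x => by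
      induction x with
      | zero => simp
      | tmul a b => simp [counitApp, TensorProduct.smul_tmul]
      | add x y hx hy => simp only [TensorProduct.add_tmul, map_add, hx, hy]
    simp [comulApp, this, h]

lemma lTensor_comulApp_comp_comulApp (k : Type u) [Field k] (C : Type u) [AddCommGroup C] [Module k C] [Coalgebra k C]
    (M : Type u) [AddCommGroup M] [Module k M]  :
   (comulApp k C M).lTensor C ∘ₗ comulApp k C M = comulApp k C (C ⊗[k] M) ∘ₗ comulApp k C M :=
  TensorProduct.ext' fun c m => by
    have h := Coalgebra.coassoc_apply (R := k) c
    let e : C ⊗[k] (C ⊗[k] C) →ₗ[k] C ⊗[k] (C ⊗[k] (C ⊗[k] M)) :=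
      ((TensorProduct.assoc k C C M).toLinearMap ∘ₗ (TensorProduct.mk k (C ⊗[k] C) M).flip m).lTensor C
    have h1 : ∀ x : C ⊗[k] C, (comulApp k C M).lTensor C (TensorProduct.assoc k C C M (x ⊗ₜ m)) =
       e ((Coalgebra.comul (R := k) (A := C)).lTensor C x) := fun x => by
      induction x with
      | zero => simp
      | tmul a b => simp [comulApp, e]
      | add x y hx hy => simp only [TensorProduct.add_tmul, map_add, hx, hy]
    have h2 : ∀ x : C ⊗[k] C, comulApp k C (C ⊗[k] M) (TensorProduct.assoc k C C M (x ⊗ₜ m)) =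
       e (TensorProduct.assoc k C C C ((Coalgebra.comul (R := k) (A := C)).rTensor C x)) := fun x => by
      induction x with
      | zero => simp
      | tmul a b =>
        simp only [comulApp, TensorProduct.assoc_tmul, LinearMap.comp_apply, LinearMap.rTensor_tmul, LinearEquiv.coe_coe]
        generalize Coalgebra.comul (R := k) a = z
        induction z with
        | zero => simp
        | tmul a b => simp [e]
        | add x y hx hy => simp only [TensorProduct.add_tmul, map_add, hx, hy]
      | add x y hx hy => simp only [TensorProduct.add_tmul, map_add, hx, hy]
    rw [LinearMap.comp_apply, LinearMap.comp_apply]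
    have : comulApp k C M (c ⊗ₜ m) = TensorProduct.assoc k C C M (Coalgebra.comul (R := k) c ⊗ₜ m) := rfl
    rw [this, h1, h2, h]

/-- The comonad `M ↦ C ⊗ M` on `k`-vector spaces attached to a `k`-coalgebra `C`. -/
def comoduleComonad (k : Type u) [Field k] (C : Type u) [AddCommGroup C] [Module k C] [Coalgebra k C] :
    Comonad (ModuleCat.{u} k) where
  toFunctor := tensorLeft (ModuleCat.of k C)
  ε :=
    { app := fun M => ModuleCat.ofHom (counitApp k C M)
      naturality := fun M N f => ModuleCat.hom_ext <| TensorProduct.ext' fun c m => by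
        change counitApp k C N (c ⊗ₜ f.hom m) = f.hom (counitApp k C M (c ⊗ₜ m))
        simp [counitApp] }
  δ :=
    { app := fun M => ModuleCat.ofHom (comulApp k C M)
      naturality := fun M N f => ModuleCat.hom_ext (comulApp_naturality k C M N f.hom).symm }
  coassoc M := ModuleCat.hom_ext (lTensor_comulApp_comp_comulApp k C M)
  left_counit M := ModuleCat.hom_ext (counitApp_comp_comulApp k C M)
  right_counit M := ModuleCat.hom_ext (lTensor_counitApp_comp_comulApp k C M)

/-- The category of left `C`-comodules: `k`-vector spaces `M` with a coaction `M → C ⊗ M` which is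
counital and coassociative; morphisms are the `C`-colinear maps. -/
abbrev ComoduleCat (k : Type u) [Field k] (C : Type u) [AddCommGroup C] [Module k C]
    [Coalgebra k C] : Type (u + 1) :=
  (comoduleComonad k C).Coalgebra

namespace ComoduleCat

/-- The comodule given by a vector space and a counital coassociative coaction. -/
def of (k : Type u) [Field k] (C : Type u) [AddCommGroup C] [Module k C]
    [Coalgebra k C] (M : Type u) [AddCommGroup M] [Module k M] (ρ : M →ₗ[k] C ⊗[k] M)
    (counit : ∀ m, TensorProduct.lid k M ((Coalgebra.counit (R := k) (A := C)).rTensor M (ρ m)) = m)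
    (coassoc : ∀ m, TensorProduct.assoc k C C M
      ((Coalgebra.comul (R := k) (A := C)).rTensor M (ρ m)) = ρ.lTensor C (ρ m)) :
    ComoduleCat k C where
  A := ModuleCat.of k M
  a := ModuleCat.ofHom ρ
  counit := ModuleCat.hom_ext (LinearMap.ext counit)
  coassoc := ModuleCat.hom_ext (LinearMap.ext coassoc)

/-- The coaction `M → C ⊗ M` of a left comodule. -/
def coaction {k : Type u} [Field k] {C : Type u} [AddCommGroup C] [Module k C] [Coalgebra k C]
    (M : ComoduleCat k C) : M.A →ₗ[k] C ⊗[k] M.A :=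
  M.a.hom

lemma coaction_counit {k : Type u} [Field k] {C : Type u} [AddCommGroup C] [Module k C]
    [Coalgebra k C] (M : ComoduleCat k C) (m : M.A) :
    TensorProduct.lid k M.A
      ((Coalgebra.counit (R := k) (A := C)).rTensor M.A (coaction M m)) = m :=
  LinearMap.congr_fun (ModuleCat.hom_ext_iff.mp M.counit) m

lemma coaction_coassoc {k : Type u} [Field k] {C : Type u} [AddCommGroup C] [Module k C]
    [Coalgebra k C] (M : ComoduleCat k C) (m : M.A) :
    TensorProduct.assoc k C C M.A
      ((Coalgebra.comul (R := k) (A := C)).rTensor M.A (coaction M m)) =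
      (coaction M).lTensor C (coaction M m) :=
  LinearMap.congr_fun (ModuleCat.hom_ext_iff.mp M.coassoc) m

/-- A morphism of comodules commutes with the coactions. -/
lemma hom_colinear {k : Type u} [Field k] {C : Type u} [AddCommGroup C] [Module k C]
    [Coalgebra k C] {M N : ComoduleCat k C} (f : M ⟶ N) (m : M.A) :
    f.f.hom.lTensor C (coaction M m) = coaction N (f.f.hom m) :=
  LinearMap.congr_fun (ModuleCat.hom_ext_iff.mp f.h) m

/-- The morphism of comodules given by a colinear map. -/
def homOfColinear {k : Type u} [Field k] {C : Type u} [AddCommGroup C] [Module k C]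
    [Coalgebra k C] {M N : ComoduleCat k C} (f : M.A →ₗ[k] N.A)
    (hf : ∀ m, f.lTensor C (coaction M m) = coaction N (f m)) : M ⟶ N where
  f := ModuleCat.ofHom f
  h := ModuleCat.hom_ext (LinearMap.ext hf)

/-- The functor sending a comodule to its underlying vector space. -/
abbrev forget (k : Type u) [Field k] (C : Type u) [AddCommGroup C] [Module k C]
    [Coalgebra k C] : ComoduleCat k C ⥤ ModuleCat.{u} k :=
  (comoduleComonad k C).forget

end ComoduleCat

instance (k : Type u) [Field k] (C : Type u) [AddCommGroup C] [Module k C]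
    [Coalgebra k C] : PreservesFiniteLimits (comoduleComonad k C).toFunctor :=
  inferInstanceAs (PreservesFiniteLimits (tensorLeft (ModuleCat.of k C)))

instance (k : Type u) [Field k] (C : Type u) [AddCommGroup C] [Module k C]
    [Coalgebra k C] : (comoduleComonad k C).toFunctor.Additive :=
  inferInstanceAs ((tensorLeft (ModuleCat.of k C)).Additive)

instance (k : Type u) [Field k] (C : Type u) [AddCommGroup C] [Module k C]
    [Coalgebra k C] : HasFiniteLimits (ComoduleCat k C) :=
  ⟨fun _ _ _ =>
    hasLimitsOfShape_of_hasLimitsOfShape_createsLimitsOfShape (comoduleComonad k C).forget⟩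

instance (k : Type u) [Field k] (C : Type u) [AddCommGroup C] [Module k C]
    [Coalgebra k C] : HasFiniteColimits (ComoduleCat k C) :=
  ⟨fun _ _ _ =>
    hasColimitsOfShape_of_hasColimitsOfShape_createsColimitsOfShape (comoduleComonad k C).forget⟩

instance (k : Type u) [Field k] (C : Type u) [AddCommGroup C] [Module k C]
    [Coalgebra k C] : PreservesFiniteLimits (comoduleComonad k C).forget :=
  ⟨fun _ _ _ => inferInstance⟩

instance (k : Type u) [Field k] (C : Type u) [AddCommGroup C] [Module k C]
    [Coalgebra k C] {X Y : ComoduleCat k C} (f : X ⟶ Y) :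
    IsIso (Abelian.coimageImageComparison f) := by
  rw [← isIso_iff_of_reflects_iso _ (comoduleComonad k C).forget,
    Arrow.isIso_iff_isIso_of_isIso
      (Abelian.PreservesCoimageImageComparison.iso (comoduleComonad k C).forget f).hom]
  infer_instance

instance (k : Type u) [Field k] (C : Type u) [AddCommGroup C] [Module k C]
    [Coalgebra k C] : Abelian (ComoduleCat k C) :=
  Abelian.ofCoimageImageComparisonIsIso

/-! ### The derived category and the homotopy categories of injective comodules -/

instance (k : Type u) [Field k] (C : Type u) [AddCommGroup C] [Module k C]
    [Coalgebra k C] : HasDerivedCategory.{u + 1} (ComoduleCat k C) :=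
  HasDerivedCategory.standard _

/-- `D⁺(C)`: the full subcategory of the derived category of left `C`-comodules on the objects
isomorphic to left-bounded complexes. -/
abbrev DPlus (k : Type u) [Field k] (C : Type u) [AddCommGroup C] [Module k C]
    [Coalgebra k C] : Type (u + 1) :=
  DerivedCategory.Plus (ComoduleCat k C)

/-- `H_I⁺(C)`: left-bounded complexes of injective left `C`-comodules, with homotopy classes of
maps as morphisms. -/
abbrev HIPlus (k : Type u) [Field k] (C : Type u) [AddCommGroup C] [Module k C]
    [Coalgebra k C] : Type (u + 1) :=
  HomotopyCategory.Plus (InjectiveObject (ComoduleCat k C))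

/-- The objects of `H_I⁺(C)` that are isomorphic (i.e. homotopy equivalent) to a bounded complex of
injective comodules. -/
def isBounded (k : Type u) [Field k] (C : Type u) [AddCommGroup C] [Module k C]
    [Coalgebra k C] : ObjectProperty (HIPlus k C) := fun K =>
  ∃ (L : HIPlus k C) (a b : ℤ), CochainComplex.IsStrictlyGE L.obj.as a ∧
    CochainComplex.IsStrictlyLE L.obj.as b ∧ Nonempty (K ≅ L)

/-- `H_I^b(C)`, as a full subcategory of `H_I⁺(C)`. -/
abbrev HIBounded (k : Type u) [Field k] (C : Type u) [AddCommGroup C] [Module k C]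
    [Coalgebra k C] : Type (u + 1) :=
  (isBounded k C).FullSubcategory

/-- Two pretriangulated categories are equivalent as triangulated categories. -/
def TriangulatedEquivalent (S : Type*) [Category* S] [HasZeroObject S] [HasShift S ℤ]
    [Preadditive S] [∀ n : ℤ, (shiftFunctor S n).Additive] [Pretriangulated S]
    (T : Type*) [Category* T] [HasZeroObject T] [HasShift T ℤ]
    [Preadditive T] [∀ n : ℤ, (shiftFunctor T n).Additive] [Pretriangulated T] : Prop :=
  ∃ (e : S ≌ T) (_ : e.functor.CommShift ℤ), e.functor.IsTriangulated

/-- The functor `F : H_I⁺(C) ⥤ H_I⁺(D)` maps `H_I^b(C)` into `H_I^b(D)`, and the functor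
`H_I^b(C) ⥤ H_I^b(D)` it induces is an equivalence of categories. -/
def RestrictsToBoundedEquivalence {k : Type u} [Field k]
    {C : Type u} [AddCommGroup C] [Module k C] [Coalgebra k C]
    {D : Type u} [AddCommGroup D] [Module k D] [Coalgebra k D]
    (F : HIPlus k C ⥤ HIPlus k D) : Prop :=
  ∃ h : ∀ K : HIBounded k C, isBounded k D (F.obj K.obj),
    ((isBounded k D).lift ((isBounded k C).ι ⋙ F) h).IsEquivalence

end CoalgComod

end

noncomputable section

namespace CoalgComod

/-! There are enough injective comodules and left-bounded complexes of injectives are K-injective,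
so `H_I⁺ → D⁺` is a triangulated equivalence; the first claim follows by composing.

For the second, `H_I^b` is characterised inside `H_I⁺` by Hom and shift alone (`isBounded_iff`): `K`
is bounded up to homotopy iff for each `X` every map `X ⟶ K⟦n⟧` vanishes for `n` large. Bounded
complexes satisfy this for degree reasons. Conversely, test `K` against the coproduct of all its
cycle objects `Zⁿ`: one bound `N` then serves every `Zⁿ`, and for `n ≥ N` the inclusion of `Zⁿ` into
`K` is null-homotopic. Hence `Kⁿ⁻¹ → Zⁿ` splits, `K` is exact in degrees at least `N`, and `Z^N` is
injective, so truncating at `N` gives a bounded complex of injectives homotopy equivalent to `K`. -/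

lemma TriangulatedEquivalent.symm {S : Type*} [Category* S] [HasZeroObject S] [HasShift S ℤ]
    [Preadditive S] [∀ n : ℤ, (shiftFunctor S n).Additive] [Pretriangulated S]
    {T : Type*} [Category* T] [HasZeroObject T] [HasShift T ℤ]
    [Preadditive T] [∀ n : ℤ, (shiftFunctor T n).Additive] [Pretriangulated T]
    (h : TriangulatedEquivalent S T) : TriangulatedEquivalent T S := by
  obtain ⟨e, _, _⟩ := h
  let := e.commShiftInverse ℤ
  have := e.commShift_of_functor ℤ
  exact ⟨e.symm, inferInstanceAs (e.inverse.CommShift ℤ),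
    e.toAdjunction.isTriangulated_rightAdjoint⟩

lemma TriangulatedEquivalent.trans {S : Type*} [Category* S] [HasZeroObject S] [HasShift S ℤ]
    [Preadditive S] [∀ n : ℤ, (shiftFunctor S n).Additive] [Pretriangulated S]
    {T : Type*} [Category* T] [HasZeroObject T] [HasShift T ℤ]
    [Preadditive T] [∀ n : ℤ, (shiftFunctor T n).Additive] [Pretriangulated T]
    {U : Type*} [Category* U] [HasZeroObject U] [HasShift U ℤ]
    [Preadditive U] [∀ n : ℤ, (shiftFunctor U n).Additive] [Pretriangulated U]
    (h : TriangulatedEquivalent S T) (h' : TriangulatedEquivalent T U) :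
    TriangulatedEquivalent S U := by
  obtain ⟨e, _, _⟩ := h
  obtain ⟨e', _, _⟩ := h'
  exact ⟨e.trans e', inferInstanceAs ((e.functor ⋙ e'.functor).CommShift ℤ),
    inferInstanceAs (e.functor ⋙ e'.functor).IsTriangulated⟩

lemma TriangulatedEquivalent.of_functor {S : Type*} [Category* S] [HasZeroObject S] [HasShift S ℤ]
    [Preadditive S] [∀ n : ℤ, (shiftFunctor S n).Additive] [Pretriangulated S]
    {T : Type*} [Category* T] [HasZeroObject T] [HasShift T ℤ]
    [Preadditive T] [∀ n : ℤ, (shiftFunctor T n).Additive] [Pretriangulated T]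
    (F : S ⥤ T) [F.CommShift ℤ] [F.IsTriangulated] [F.IsEquivalence] :
    TriangulatedEquivalent S T :=
  ⟨F.asEquivalence, inferInstanceAs (F.CommShift ℤ), inferInstanceAs F.IsTriangulated⟩

/-! ### Injectives and coproducts of comodules -/

section Comodules

variable (k : Type u) [Field k] (C : Type u) [AddCommGroup C] [Module k C] [Coalgebra k C]

/-- The forgetful functor to vector spaces is faithful and exact, so its right adjoint, the cofree
comodule, supplies injectives. -/
instance : EnoughInjectives (ComoduleCat k C) :=
  EnoughInjectives.of_adjunction (comoduleComonad k C).adj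

instance (J : Type u) : HasCoproductsOfShape J (ComoduleCat k C) :=
  hasColimitsOfShape_of_hasColimitsOfShape_createsColimitsOfShape (comoduleComonad k C).forget

end Comodules

/-! ### Complexes of injectives as a model of `D⁺` -/

section Abelian

variable {A : Type*} [Category* A] [Abelian A]

/-- Maps into a K-injective complex are the same up to homotopy as in the derived category, which
gives full faithfulness. -/
instance [HasDerivedCategory A] [EnoughInjectives A] :
    ((InjectiveObject.ι A).mapHomotopyCategoryPlus ⋙ DerivedCategory.Plus.Qh).IsEquivalence := by
  have h (K L : HomotopyCategory.Plus (InjectiveObject A)) : Function.Bijective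
      (((InjectiveObject.ι A).mapHomotopyCategoryPlus ⋙ DerivedCategory.Plus.Qh).map :
        (K ⟶ L) → _) := by
    obtain ⟨L, rfl⟩ := HomotopyCategory.Plus.quotient_obj_surjective L
    exact (DerivedCategory.Plus.Qh_map_bijective_of_isKInjective _ _
        (inferInstanceAs (CochainComplex.IsKInjective
          (((InjectiveObject.ι A).mapHomologicalComplex (.up ℤ)).obj L.obj)))).comp
      ((Functor.FullyFaithful.ofFullyFaithful
        (InjectiveObject.ι A).mapHomotopyCategoryPlus).map_bijective K _)
  exact
    { full := ⟨fun {K L} => (h K L).2⟩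
      faithful := ⟨fun {K L} _ _ => (h K L).1 (a₁ := _) (a₂ := _)⟩
      essSurj := inferInstance }

end Abelian

lemma triangulatedEquivalent_HIPlus_DPlus (k : Type u) [Field k] (C : Type u) [AddCommGroup C]
    [Module k C] [Coalgebra k C] : TriangulatedEquivalent (HIPlus k C) (DPlus k C) :=
  .of_functor ((InjectiveObject.ι (ComoduleCat k C)).mapHomotopyCategoryPlus ⋙
    DerivedCategory.Plus.Qh)

/-- Every object `X` admits only zero maps to the shifts `K⟦n⟧` for `n` large (depending on
`X`). -/
def EventuallyRightOrthogonal {S : Type*} [Category* S] [Preadditive S] [HasShift S ℤ]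
    (K : S) : Prop :=
  ∀ X : S, ∃ N : ℤ, ∀ n ≥ N, ∀ f : X ⟶ K⟦n⟧, f = 0

lemma eventuallyRightOrthogonal_map_iff {S T : Type*} [Category* S] [Preadditive S]
    [HasShift S ℤ] [Category* T] [Preadditive T] [HasShift T ℤ] (F : S ⥤ T) [F.CommShift ℤ]
    [F.IsEquivalence] [F.Additive] (K : S) :
    EventuallyRightOrthogonal (F.obj K) ↔ EventuallyRightOrthogonal K := by
  constructor
  · intro h X
    obtain ⟨N, hN⟩ := h (F.obj X)
    refine ⟨N, fun n hn f => F.map_injective ?_⟩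
    rw [F.map_zero, ← cancel_mono ((F.commShiftIso n).hom.app K), zero_comp]
    exact hN n hn _
  · intro h Y
    obtain ⟨N, hN⟩ := h (F.objPreimage Y)
    refine ⟨N, fun n hn f => ?_⟩
    obtain ⟨g, hg⟩ := F.map_surjective
      ((F.objObjPreimageIso Y).hom ≫ f ≫ (F.commShiftIso n).inv.app K)
    rw [hN n hn g, F.map_zero] at hg
    simpa using hg.symm

lemma EventuallyRightOrthogonal.of_iso {S : Type*} [Category* S] [Preadditive S] [HasShift S ℤ]
    {K L : S} (e : K ≅ L) (h : EventuallyRightOrthogonal K) : EventuallyRightOrthogonal L := by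
  intro X
  obtain ⟨N, hN⟩ := h X
  refine ⟨N, fun n hn f => ?_⟩
  rw [← cancel_mono (e.inv⟦n⟧'), zero_comp]
  exact hN n hn _

/-! ### Detecting boundedness up to homotopy -/

section BoundedComplexes

variable {A : Type*} [Category* A] [Abelian A]

/-- If the inclusion of the cycles in degree `j`, viewed as a morphism of complexes from a single
complex, is null-homotopic, then the differential onto the cycles is a split epimorphism. -/
lemma exists_section_toCycles (L : CochainComplex A ℤ) (i j : ℤ) (hij : i + 1 = j)
    (h : ∀ f : (HomologicalComplex.single A (.up ℤ) j).obj (L.cycles j) ⟶ L,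
      Nonempty (Homotopy f 0)) :
    ∃ s : L.cycles j ⟶ L.X i, s ≫ L.toCycles i j = 𝟙 _ := by
  obtain ⟨H⟩ := h (HomologicalComplex.mkHomFromSingle (L.iCycles j) (by simp))
  refine ⟨(HomologicalComplex.singleObjXSelf (.up ℤ) j (L.cycles j)).inv ≫ H.hom j i, ?_⟩
  have h1 := H.comm j
  -- The single complex has zero differential, so only the term `H.hom j i` followed by `d`
  -- survives; `d` factors through the cycles.
  rw [dNext_eq (i := j) (i' := j + 1) _ (by simp), prevD_eq (j := j) (j' := i) _ (by simpa)] at h1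
  rw [← cancel_mono (L.iCycles j)]
  have h2 := (HomologicalComplex.singleObjXSelf (.up ℤ) j (L.cycles j)).inv ≫= h1
  simpa using h2.symm

lemma exactAt_of_section_toCycles (L : CochainComplex A ℤ) (i j : ℤ)
    (s : L.cycles j ⟶ L.X i) (hs : s ≫ L.toCycles i j = 𝟙 _) : L.ExactAt j := by
  have : Epi (L.toCycles i j) := epi_of_epi_fac hs
  have : L.homologyπ j = 0 := by
    rw [← cancel_epi (L.toCycles i j), L.toCycles_comp_homologyπ, comp_zero]
  rw [L.exactAt_iff_isZero_homology, IsZero.iff_id_eq_zero, ← cancel_epi (L.homologyπ j), this]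
  simp

/-- Only in degree `N`, where the truncation has the cycles, can injectivity fail. -/
lemma injective_truncLE_X (L : CochainComplex A ℤ) [∀ n, Injective (L.X n)] (N : ℤ)
    (h : Injective (L.cycles N)) (n : ℤ) : Injective ((L.truncLE N).X n) := by
  obtain hn | rfl | hn := lt_trichotomy n N
  · exact .of_iso (L.truncLEXIso N n hn).symm inferInstance
  · exact .of_iso (L.truncLEXIsoCycles n).symm h
  · exact (CochainComplex.isZero_of_isStrictlyLE _ N n hn).injective

lemma exists_bounded_iso (K : HomotopyCategory.Plus (InjectiveObject A)) (N : ℤ)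
    (h : ∀ n ≥ N, ∀ f : (HomologicalComplex.single A (.up ℤ) n).obj
        ((((InjectiveObject.ι A).mapHomologicalComplex (.up ℤ)).obj K.obj.as).cycles n) ⟶
          ((InjectiveObject.ι A).mapHomologicalComplex (.up ℤ)).obj K.obj.as,
      Nonempty (Homotopy f 0)) :
    ∃ (L : HomotopyCategory.Plus (InjectiveObject A)) (a b : ℤ),
      CochainComplex.IsStrictlyGE L.obj.as a ∧
      CochainComplex.IsStrictlyLE L.obj.as b ∧ Nonempty (K ≅ L) := by
  obtain ⟨⟨K, a, ha⟩, rfl⟩ := HomotopyCategory.Plus.quotient_obj_surjective K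
  let M : CochainComplex A ℤ := ((InjectiveObject.ι A).mapHomologicalComplex (.up ℤ)).obj K
  have : M.IsStrictlyGE a := by
    rwa [CochainComplex.isStrictlyGE_mapHomologicalComplex_obj_iff]
  have hM (n : ℤ) : Injective (M.X n) :=
    inferInstanceAs (Injective ((InjectiveObject.ι A).obj (K.X n)))
  have hs (n : ℤ) (hn : n ≥ N) := exists_section_toCycles M (n - 1) n (by simp) (h n hn)
  have : M.IsLE N := by
    rw [CochainComplex.isLE_iff]
    intro i hi
    obtain ⟨s, hs⟩ := hs i hi.le
    exact exactAt_of_section_toCycles M _ i s hs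
  have hT : ∀ n, Injective ((M.truncLE N).X n) := by
    apply injective_truncLE_X
    obtain ⟨s, hs⟩ := hs N le_rfl
    -- The section makes the cycles in degree `N` a retract of the injective `M.X (N - 1)`.
    exact Retract.injective ⟨s, _, hs⟩
  have := CochainComplex.isKInjective_of_injective (M.truncLE N) a
  have := CochainComplex.isKInjective_of_injective M a
  let L : CochainComplex (InjectiveObject A) ℤ :=
    HomologicalComplex.liftObjectProperty _ (M.truncLE N) hT
  have hLa : L.IsStrictlyGE a := by
    rw [← CochainComplex.isStrictlyGE_mapHomologicalComplex_obj_iff L (InjectiveObject.ι _)]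
    exact inferInstanceAs ((M.truncLE N).IsStrictlyGE a)
  have hLb : L.IsStrictlyLE N := by
    rw [← CochainComplex.isStrictlyLE_mapHomologicalComplex_obj_iff L (InjectiveObject.ι _)]
    exact inferInstanceAs ((M.truncLE N).IsStrictlyLE N)
  refine ⟨(HomotopyCategory.Plus.quotient _).obj ⟨L, a, hLa⟩, a, N, hLa, hLb, ?_⟩
  -- A quasi-isomorphism between K-injective complexes is a homotopy equivalence.
  have hq : HomologicalComplex.homotopyEquivalences A (.up ℤ) (M.ιTruncLE N) :=
    (CochainComplex.IsKInjective.quasiIso_iff _).1 inferInstance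
  obtain ⟨e, -⟩ := hq
  let e' : (InjectiveObject.ι A).mapHomotopyCategoryPlus.obj
      ((HomotopyCategory.Plus.quotient _).obj ⟨L, a, hLa⟩) ≅
      (InjectiveObject.ι A).mapHomotopyCategoryPlus.obj
        ((HomotopyCategory.Plus.quotient _).obj ⟨K, a, ha⟩) :=
    ObjectProperty.isoMk _ (HomotopyCategory.isoOfHomotopyEquiv e)
  exact ⟨((InjectiveObject.ι A).mapHomotopyCategoryPlus.preimageIso e').symm⟩

lemma eventuallyRightOrthogonal_of_bounded (K : HomotopyCategory.Plus (InjectiveObject A)) (b : ℤ)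
    (hb : CochainComplex.IsStrictlyLE K.obj.as b) : EventuallyRightOrthogonal K := by
  intro X
  obtain ⟨⟨X, a, ha⟩, rfl⟩ := HomotopyCategory.Plus.quotient_obj_surjective X
  obtain ⟨⟨K, hK⟩, rfl⟩ := HomotopyCategory.Plus.quotient_obj_surjective K
  have hb : K.IsStrictlyLE b := hb
  -- `X` lives in degrees at least `a`, and `K⟦n⟧` in degrees at most `b - n`, which is below `a`.
  refine ⟨b - a + 1, fun n hn f => ?_⟩
  let e : (HomotopyCategory.Plus.ι _).obj
      (((HomotopyCategory.Plus.quotient (InjectiveObject A)).obj ⟨K, hK⟩)⟦n⟧) ≅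
      (HomotopyCategory.quotient (InjectiveObject A) (.up ℤ)).obj (K⟦n⟧) :=
    ((HomotopyCategory.Plus.ι _).commShiftIso n).app _ ≪≫
      (((HomotopyCategory.quotient _ _).commShiftIso n).app K).symm
  obtain ⟨g, hg⟩ := (HomotopyCategory.quotient _ _).map_surjective (X := X) (Y := K⟦n⟧)
    ((HomotopyCategory.Plus.ι _).map f ≫ e.hom)
  have : g = 0 := by
    apply HomologicalComplex.hom_ext
    intro i
    by_cases hi : i < a
    · exact (CochainComplex.isZero_of_isStrictlyGE X a i hi).eq_of_src _ _
    · exact (CochainComplex.isZero_of_isStrictlyLE K b (i + n) (by omega)).eq_of_tgt _ _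
  rw [this, Functor.map_zero] at hg
  apply (HomotopyCategory.Plus.ι _).map_injective
  rw [Functor.map_zero, ← cancel_mono e.hom, zero_comp]
  exact hg.symm

lemma exists_bounded_iso_of_eventuallyRightOrthogonal [HasDerivedCategory A] [EnoughInjectives A]
    [HasCoproductsOfShape ℤ A] (K : HomotopyCategory.Plus (InjectiveObject A))
    (h : EventuallyRightOrthogonal K) :
    ∃ (L : HomotopyCategory.Plus (InjectiveObject A)) (a b : ℤ),
      CochainComplex.IsStrictlyGE L.obj.as a ∧
      CochainComplex.IsStrictlyLE L.obj.as b ∧ Nonempty (K ≅ L) := by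
  -- In `D⁺` the coproduct, placed in degree 0, is itself a test object; no injective resolution has
  -- to be chosen.
  rw [← eventuallyRightOrthogonal_map_iff
    ((InjectiveObject.ι A).mapHomotopyCategoryPlus ⋙ DerivedCategory.Plus.Qh)] at h
  let M := (InjectiveObject.ι A).mapHomotopyCategoryPlus.obj K
  let Z (n : ℤ) : A := HomologicalComplex.cycles M.obj.as n
  obtain ⟨N, hN⟩ := h (DerivedCategory.Plus.Qh.obj
    ((HomotopyCategory.Plus.singleFunctor A 0).obj (∐ Z)))
  have hM : CochainComplex.IsKInjective M.obj.as := by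
    obtain ⟨K, rfl⟩ := HomotopyCategory.Plus.quotient_obj_surjective K
    exact inferInstanceAs (CochainComplex.IsKInjective
      (((InjectiveObject.ι A).mapHomologicalComplex (.up ℤ)).obj K.obj))
  have key (n : ℤ) (hn : n ≥ N) (f : (HomotopyCategory.Plus.singleFunctor A n).obj (Z n) ⟶ M) :
      f = 0 := by
    let e := ((HomotopyCategory.Plus.singleFunctors A).shiftIso n 0 n (by simp)).app (Z n)
    let g : (HomotopyCategory.Plus.singleFunctor A 0).obj (Z n) ⟶ M⟦n⟧ := e.inv ≫ f⟦n⟧'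
    have hg : g = 0 := by
      apply (DerivedCategory.Plus.Qh_map_bijective_of_isKInjective _ (M⟦n⟧)
        (inferInstanceAs
          (CochainComplex.IsKInjective ((show CochainComplex A ℤ from M.obj.as)⟦n⟧)))).1
      -- `g` is extended to the coproduct along the projection onto `Z n`; restricting along
      -- `Sigma.ι Z n` then recovers `g`.
      have h1 := hN n hn (DerivedCategory.Plus.Qh.map
        ((HomotopyCategory.Plus.singleFunctor A 0).map (Sigma.desc (Pi.single n (𝟙 (Z n)))) ≫ g) ≫
          (DerivedCategory.Plus.Qh.commShiftIso n).hom.app M)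
      rw [← zero_comp (Y := (DerivedCategory.Plus.Qh.obj (M⟦n⟧))), cancel_mono] at h1
      have h2 := DerivedCategory.Plus.Qh.map
        ((HomotopyCategory.Plus.singleFunctor A 0).map (Sigma.ι Z n)) ≫= h1
      rw [← Functor.map_comp, ← Functor.map_comp_assoc] at h2
      simpa using h2
    apply (shiftFunctor (HomotopyCategory.Plus A) n).map_injective
    rw [← cancel_epi e.inv]
    simpa [g] using hg
  refine exists_bounded_iso K N (fun n hn f => ⟨HomotopyCategory.homotopyOfEq _ _ ?_⟩)
  have h1 := key n hn (ObjectProperty.homMk ((HomotopyCategory.quotient _ _).map f))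
  rw [Functor.map_zero]
  exact (HomotopyCategory.Plus.ι A).congr_map h1

end BoundedComplexes

lemma isBounded_iff (k : Type u) [Field k] (C : Type u) [AddCommGroup C] [Module k C]
    [Coalgebra k C] (K : HIPlus k C) : isBounded k C K ↔ EventuallyRightOrthogonal K := by
  constructor
  · rintro ⟨L, a, b, _, hb, ⟨e⟩⟩
    exact (eventuallyRightOrthogonal_of_bounded L b hb).of_iso e.symm
  · exact exists_bounded_iso_of_eventuallyRightOrthogonal K

end CoalgComod

end

theorem mainTheorem9 (k : Type u) [Field k]
    (C : Type u) [AddCommGroup C] [Module k C] [Coalgebra k C]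
    (D : Type u) [AddCommGroup D] [Module k D] [Coalgebra k D] :
    (CoalgComod.TriangulatedEquivalent (CoalgComod.DPlus k C) (CoalgComod.DPlus k D) ↔
      CoalgComod.TriangulatedEquivalent (CoalgComod.HIPlus k C) (CoalgComod.HIPlus k D)) ∧
    ∀ (F : CoalgComod.HIPlus k C ≌ CoalgComod.HIPlus k D) [F.functor.CommShift ℤ]
      [F.functor.IsTriangulated], CoalgComod.RestrictsToBoundedEquivalence F.functor := by
  have hC := CoalgComod.triangulatedEquivalent_HIPlus_DPlus k C
  have hD := CoalgComod.triangulatedEquivalent_HIPlus_DPlus k D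
  refine ⟨⟨fun h => (hC.trans h).trans hD.symm, fun h => (hC.symm.trans h).trans hD⟩, ?_⟩
  intro F _ _
  have hF (K : CoalgComod.HIPlus k C) :
      CoalgComod.isBounded k D (F.functor.obj K) ↔ CoalgComod.isBounded k C K := by
    rw [CoalgComod.isBounded_iff, CoalgComod.isBounded_iff,
      CoalgComod.eventuallyRightOrthogonal_map_iff]
  refine ⟨fun K => (hF K.obj).2 K.property, { essSurj := ⟨fun L => ?_⟩ }⟩
  -- Going through `F.functor` and the counit avoids putting a shift structure on the inverse.
  have hL : CoalgComod.isBounded k D (F.functor.obj (F.inverse.obj L.obj)) := by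
    rw [CoalgComod.isBounded_iff]
    exact ((CoalgComod.isBounded_iff k D L.obj).1 L.property).of_iso
      (F.counitIso.symm.app L.obj)
  exact ⟨⟨F.inverse.obj L.obj, (hF _).1 hL⟩,
    ⟨(CoalgComod.isBounded k D).isoMk (F.counitIso.app L.obj)⟩⟩
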